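/- Let $V$ be a finite-dimensional real Euclidean space with inner product $\langle-,-\rangle$, and for $0\ne\alpha\in V$ let $s_\alpha$ be the orthogonal reflection $v\mapsto v-\frac{2\langle v,\alpha\rangle}{\langle\alpha,\alpha\rangle}\alpha$. Let $\Phi\subseteq V\setminus\{0\}$ be a root system, i.e. a finite set with $s_\alpha(\beta)\in\Phi$ for $\alpha,\beta\in\Phi$, and such that $\alpha,c\alpha\in\Phi$ with $c\in\mathbb R$ implies $c=\pm1$; let $W=\langle s_\alpha\mid\alpha\in\Phi\rangle$. For $A\subseteq\Phi$ put $W_A=\langle s_\alpha\mid\alpha\in A\rangle$ and $\Phi_A=\{\alpha\in\Phi\mid s_\alpha\in W_A\}$; the sets $\Phi_A$ are the root subsystems of $\Phi$. A simple system of a root system $\Psi$ is a linearly independent subset $\Delta\subseteq\Psi$ with $\Psi=\Psi_+\sqcup(-\Psi_+)$, where $\Psi_+=\Psi\cap\mathbb R_{\ge0}\Delta$. A simple subsystem $\Gamma$ of $\Phi$ is a simple system of some root subsystem of $\Phi$; put $\Phi_{\Gamma,+}=\Phi_\Gamma\cap\mathbb R_{\ge0}\Gamma$ and $S_\Gamma=\{s_\alpha\mid\alpha\in\Gamma\}$.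 For simple subsystems $\Gamma',\Gamma$ with $W_{\Gamma'}\subseteq W_\Gamma$ let $${}^{\Gamma'}W_\Gamma=\{w\in W_\Gamma\mid w^{-1}(\Gamma')\subseteq\Phi_{\Gamma,+}\},$$ a set of representatives of $W_{\Gamma'}\backslash W_\Gamma$. For $\Delta\subseteq\Gamma$ let $\mathcal C_{\Gamma,\Delta}=\{v\in V\mid \langle v,\alpha\rangle>0\ (\alpha\in\Gamma\setminus\Delta),\ \langle v,\alpha\rangle=0\ (\alpha\in\Delta)\}$. Let $\mathcal I^{(n)}_\Gamma$ be the set of sequences $\boldsymbol\Gamma=(\Gamma_0,\dots,\Gamma_n)$ with $\Gamma=\Gamma_0\supseteq\Gamma_1\supseteq\dots\supseteq\Gamma_n$, and put $\mathcal X_{\boldsymbol\Gamma}=\mathcal C_{\Gamma_0,\Gamma_1}\times\dots\times\mathcal C_{\Gamma_{n-1},\Gamma_n}\subseteq V^n$. With $W$ acting diagonally on $V^n$, the $(W_\Gamma,S_\Gamma)$-strata of $V^n$ are the sets $u(\mathcal X_{\boldsymbol\Gamma})$ with $u\in W_\Gamma$ and $\boldsymbol\Gamma\in\mathcal I^{(n)}_\Gamma$.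 The dimension of a non-empty cone is the dimension of its linear span. **Theorem.** Let $\Gamma,\Lambda$ be simple subsystems of $\Phi$ with $W_\Gamma\subseteq W_\Lambda$, and let $n\ge1$. 1. The topological closure of any $(W_\Gamma,S_\Gamma)$-stratum of $V^n$ is a union of $(W_\Lambda,S_\Lambda)$-strata of $V^n$. 2. Explicitly, let $u(\mathcal X_{\boldsymbol\Gamma})$ be a $(W_\Gamma,S_\Gamma)$-stratum, where $u\in W_\Gamma$ and $\boldsymbol\Gamma=(\Gamma_0,\dots,\Gamma_n)\in\mathcal I^{(n)}_\Gamma$, and put $\Gamma_i'=u(\Gamma_i)$. Then $$\overline{u(\mathcal X_{\boldsymbol\Gamma})}=\bigcup_{\mathbf w,\boldsymbol\Lambda}w_n\cdots w_1(\mathcal X_{\boldsymbol\Lambda}),$$ where the union is over all $\mathbf w=(w_1,\dots,w_n)\in W^n$ and $\boldsymbol\Lambda=(\Lambda_0,\dots,\Lambda_n)\in\mathcal I^{(n)}_\Lambda$ such that for $i=1,\dots,n$: (i) $w_i\in{}^{\Gamma'_{i-1}}W_{w_{i-1}\cdots w_1(\Lambda_{i-1})}$, and (ii) $W_{w_i\cdots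 w_1(\Lambda_i)}\supseteq W_{\Gamma'_i}$. 3. The closure of any $(W_\Gamma,S_\Gamma)$-stratum $F$ of $V^n$ is the disjoint union of $F$ and of $(W_\Gamma,S_\Gamma)$-strata of $V^n$ of dimension strictly less than $\dim F$. 4. Every $(W_\Gamma,S_\Gamma)$-stratum of $V^n$ is a union of $(W_\Lambda,S_\Lambda)$-strata of $V^n$. -/

import Mathlib

open scoped NNReal InnerProductSpace

namespace ReflStrata

noncomputable section

variable {V : Type*} [NormedAddCommGroup V] [InnerProductSpace ℝ V]

/-- The orthogonal reflection `s_α` in (the hyperplane orthogonal to) `α`. -/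
def refl (α : V) : V ≃ₗᵢ[ℝ] V := (ℝ ∙ α)ᗮ.reflection

theorem refl_apply (α v : V) : refl α v = v - (2 * ⟪v, α⟫_ℝ / ⟪α, α⟫_ℝ) • α := by
  rw [refl, Submodule.reflection_orthogonal_apply, Submodule.reflection_singleton_apply]
  rw [real_inner_comm, real_inner_self_eq_norm_sq, neg_sub, ← Nat.cast_smul_eq_nsmul ℝ, smul_smul]
  congr 2
  push_cast
  simp only [RCLike.ofReal_real_eq_id, id]
  ring

/-- A (finite, reduced, not necessarily crystallographic or spanning) root system in `V`. -/
structure IsRootSystem (Φ : Set V) : Prop where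
  finite : Φ.Finite
  zero_notMem : (0 : V) ∉ Φ
  refl_mem : ∀ α ∈ Φ, ∀ β ∈ Φ, refl α β ∈ Φ
  reduced : ∀ α ∈ Φ, ∀ c : ℝ, c • α ∈ Φ → c = 1 ∨ c = -1

/-- The group generated by the reflections `s_α`, `α ∈ A`.  Thus `reflGroup Φ` is `W` and
`reflGroup Γ` is `W_Γ`. -/
def reflGroup (A : Set V) : Subgroup (V ≃ₗᵢ[ℝ] V) := Subgroup.closure (refl '' A)

/-- The roots `{α ∈ Φ | s_α ∈ W'}` of a subgroup `W'`. -/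
def rootsOf (Φ : Set V) (W' : Subgroup (V ≃ₗᵢ[ℝ] V)) : Set V := {α | α ∈ Φ ∧ refl α ∈ W'}

/-- A root subsystem of `Φ`: the set of roots of a subgroup generated by some of the
reflections `s_α`, `α ∈ Φ`. -/
def IsRootSubsystem (Φ Ψ : Set V) : Prop := ∃ A ⊆ Φ, Ψ = rootsOf Φ (reflGroup A)

/-- The elements of `Ψ` that are non-negative real linear combinations of elements of `Δ`. -/
def posRoots (Ψ Δ : Set V) : Set V := Ψ ∩ (Submodule.span ℝ≥0 Δ : Set V)

/-- `Δ` is a simple system of the root system `Ψ`. -/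
structure IsSimpleSystem (Ψ Δ : Set V) : Prop where
  subset : Δ ⊆ Ψ
  linearIndep : LinearIndepOn ℝ id Δ
  union_eq : Ψ = posRoots Ψ Δ ∪ -posRoots Ψ Δ
  disjoint : Disjoint (posRoots Ψ Δ) (-posRoots Ψ Δ)

/-- A simple subsystem of `Φ`: a simple system of some root subsystem of `Φ`. -/
def IsSimpleSubsystem (Φ Γ : Set V) : Prop :=
  ∃ Ψ, IsRootSubsystem Φ Ψ ∧ IsSimpleSystem Ψ Γ

/-- `Φ_{Γ,+}`: the positive roots, with respect to `Γ`, of the root system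
`Φ_Γ = {α ∈ Φ | s_α ∈ W_Γ}`. -/
def subPosRoots (Φ Γ : Set V) : Set V := posRoots (rootsOf Φ (reflGroup Γ)) Γ

/-- `^{Γ'}W_Γ = {w ∈ W_Γ | w⁻¹(Γ') ⊆ Φ_{Γ,+}}`. -/
def cosetReps (Φ Γ' Γ : Set V) : Set (V ≃ₗᵢ[ℝ] V) :=
  {w | w ∈ reflGroup Γ ∧ ⇑w⁻¹ '' Γ' ⊆ subPosRoots Φ Γ}

/-- `𝒞_{Γ,Δ}`. -/
def facet (Γ Δ : Set V) : Set V :=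
  {v | (∀ α ∈ Γ \ Δ, 0 < ⟪v, α⟫_ℝ) ∧ ∀ α ∈ Δ, ⟪v, α⟫_ℝ = 0}

/-- `c ∈ ℐ_Γ^{(n)}`, i.e. `Γ = c 0 ⊇ c 1 ⊇ ⋯ ⊇ c n`. -/
def IsFlag (Γ : Set V) {n : ℕ} (c : Fin (n + 1) → Set V) : Prop := c 0 = Γ ∧ Antitone c

/-- `𝒳_c = 𝒞_{c 0, c 1} × ⋯ × 𝒞_{c (n-1), c n} ⊆ V^n`. -/
def stdStratum {n : ℕ} (c : Fin (n + 1) → Set V) : Set (Fin n → V) :=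
  {v | ∀ i : Fin n, v i ∈ facet (c i.castSucc) (c i.succ)}

/-- The diagonal action of an isometry of `V` on `V^n`. -/
def diag (n : ℕ) (w : V ≃ₗᵢ[ℝ] V) (v : Fin n → V) : Fin n → V := fun i => w (v i)

/-- `F` is a `(W_Γ, S_Γ)`-stratum of `V^n`. -/
def IsStratum (Γ : Set V) {n : ℕ} (F : Set (Fin n → V)) : Prop :=
  ∃ u ∈ reflGroup Γ, ∃ c : Fin (n + 1) → Set V, IsFlag Γ c ∧ F = diag n u '' stdStratum c

/-- The product `w_k ⋯ w_1`, where `w_k` (for `1 ≤ k ≤ n`) is the entry of `w` with index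
`k - 1` in `Fin n`. -/
def revProd {n : ℕ} (w : Fin n → (V ≃ₗᵢ[ℝ] V)) (k : Fin (n + 1)) : V ≃ₗᵢ[ℝ] V :=
  Fin.induction (motive := fun _ => V ≃ₗᵢ[ℝ] V) 1 (fun i p => w i * p) k

theorem revProd_zero {n : ℕ} (w : Fin n → (V ≃ₗᵢ[ℝ] V)) : revProd w 0 = 1 := rfl

theorem revProd_succ {n : ℕ} (w : Fin n → (V ≃ₗᵢ[ℝ] V)) (i : Fin n) :
    revProd w i.succ = w i * revProd w i.castSucc := rfl

/-- The index condition `P(w, d)` relative to the flag `c`: for `k = 1, …, n`,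
(i) `w_k ∈ ^{c_{k-1}}W_{w_{k-1}⋯w_1(d_{k-1})}`, and (ii) `W_{w_k⋯w_1(d_k)} ⊇ W_{c_k}`. -/
def ClosureIndex (Φ : Set V) {n : ℕ} (c : Fin (n + 1) → Set V) (w : Fin n → (V ≃ₗᵢ[ℝ] V))
    (d : Fin (n + 1) → Set V) : Prop :=
  (∀ i : Fin n, w i ∈ cosetReps Φ (c i.castSucc) (revProd w i.castSucc '' d i.castSucc)) ∧
  (∀ i : Fin n, reflGroup (c i.succ) ≤ reflGroup (revProd w i.succ '' d i.succ))

/-- The dimension of a cone in `V^n`: the dimension of its linear span. -/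
def coneDim {n : ℕ} (F : Set (Fin n → V)) : ℕ := Module.finrank ℝ (Submodule.span ℝ F)

end

end ReflStrata

open scoped NNReal InnerProductSpace

namespace ReflStrata

variable {V : Type*} [NormedAddCommGroup V] [InnerProductSpace ℝ V]

/-! ### Reflections and reflection groups -/

theorem refl_self (α : V) : refl α α = -α := by
  rw [refl_apply]
  by_cases h : α = 0
  · simp [h]
  · have : ⟪α, α⟫_ℝ ≠ 0 := by simpa using h
    rw [mul_div_assoc, div_self this, mul_one, two_smul]
    abel

theorem refl_mul_self (α : V) : refl α * refl α = 1 := by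
  ext v
  simp [refl]

theorem refl_inv (α : V) : (refl α)⁻¹ = refl α :=
  inv_eq_of_mul_eq_one_left (refl_mul_self α)

theorem refl_of_inner_eq_zero {α v : V} (h : ⟪v, α⟫_ℝ = 0) : refl α v = v := by
  simp [refl_apply, h]

theorem inner_eq_zero_of_refl {α v : V} (h : refl α v = v) : ⟪v, α⟫_ℝ = 0 := by
  have h1 : ⟪refl α v, refl α α⟫_ℝ = ⟪v, α⟫_ℝ := (refl α).inner_map_map v α
  rw [h, refl_self, inner_neg_right] at h1
  linarith

theorem inner_inv_apply (w : V ≃ₗᵢ[ℝ] V) (x y : V) : ⟪x, w⁻¹ y⟫_ℝ = ⟪w x, y⟫_ℝ := by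
  rw [← w.inner_map_map x (w⁻¹ y)]
  congr 1
  exact w.apply_symm_apply y

theorem apply_inv_apply (w : V ≃ₗᵢ[ℝ] V) (x : V) : w (w⁻¹ x) = x := w.apply_symm_apply x

theorem inv_apply_apply (w : V ≃ₗᵢ[ℝ] V) (x : V) : w⁻¹ (w x) = x := w.symm_apply_apply x

theorem refl_map (w : V ≃ₗᵢ[ℝ] V) (α : V) : refl (w α) = w * refl α * w⁻¹ := by
  ext v
  have h : ⟪w⁻¹ v, α⟫_ℝ = ⟪v, w α⟫_ℝ := by
    rw [real_inner_comm, inner_inv_apply, real_inner_comm]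
  change refl (w α) v = w (refl α (w⁻¹ v))
  rw [refl_apply, refl_apply, map_sub, map_smul, apply_inv_apply, h, w.inner_map_map]

theorem refl_mem_reflGroup {A : Set V} {α : V} (h : α ∈ A) : refl α ∈ reflGroup A :=
  Subgroup.subset_closure ⟨α, h, rfl⟩

theorem reflGroup_mono {A B : Set V} (h : A ⊆ B) : reflGroup A ≤ reflGroup B :=
  Subgroup.closure_mono (Set.image_mono h)

theorem conj_mem_reflGroup_image {A : Set V} (w : V ≃ₗᵢ[ℝ] V) {g : V ≃ₗᵢ[ℝ] V}
    (hg : g ∈ reflGroup A) : w * g * w⁻¹ ∈ reflGroup (w '' A) := by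
  have : reflGroup A ≤ (reflGroup (w '' A)).comap (MulAut.conj w).toMonoidHom := by
    rw [reflGroup, Subgroup.closure_le]
    rintro _ ⟨α, hα, rfl⟩
    change w * refl α * w⁻¹ ∈ reflGroup (w '' A)
    rw [← refl_map]
    exact refl_mem_reflGroup ⟨α, hα, rfl⟩
  exact this hg

theorem image_inv_image (w : V ≃ₗᵢ[ℝ] V) (A : Set V) : ⇑w⁻¹ '' (w '' A) = A := by
  rw [Set.image_image]
  simp [inv_apply_apply]

theorem conj_mem_of_mem_reflGroup_image {A : Set V} (w : V ≃ₗᵢ[ℝ] V) {g : V ≃ₗᵢ[ℝ] V}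
    (hg : g ∈ reflGroup (w '' A)) : w⁻¹ * g * w ∈ reflGroup A := by
  have := conj_mem_reflGroup_image w⁻¹ hg
  rwa [image_inv_image, inv_inv] at this

theorem reflGroup_image_of_mem {A : Set V} {q : V ≃ₗᵢ[ℝ] V} (hq : q ∈ reflGroup A) :
    reflGroup (q '' A) = reflGroup A := by
  ext g
  constructor
  · intro hg
    have h := conj_mem_of_mem_reflGroup_image q hg
    have : g = q * (q⁻¹ * g * q) * q⁻¹ := by group
    rw [this]
    exact mul_mem (mul_mem hq h) (inv_mem hq)
  · intro hg
    have h := conj_mem_reflGroup_image q (mul_mem (mul_mem (inv_mem hq) hg) hq)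
    have : g = q * (q⁻¹ * g * q) * q⁻¹ := by group
    rwa [← this] at h

/-- The group generated by the reflections in `A` fixes every vector orthogonal to `A`. -/
theorem apply_eq_of_mem_reflGroup {A : Set V} {g : V ≃ₗᵢ[ℝ] V} (hg : g ∈ reflGroup A) {v : V}
    (hv : ∀ α ∈ A, ⟪v, α⟫_ℝ = 0) : g v = v := by
  rw [reflGroup] at hg
  induction hg using Subgroup.closure_induction'' with
  | one => rfl
  | mem x hx => obtain ⟨α, hα, rfl⟩ := hx; exact refl_of_inner_eq_zero (hv α hα)
  | inv_mem x hx =>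
    obtain ⟨α, hα, rfl⟩ := hx
    rw [refl_inv]; exact refl_of_inner_eq_zero (hv α hα)
  | mul x y _ _ hx hy =>
    change x (y v) = v
    rw [hy, hx]

theorem IsRootSystem.map_mem {Φ : Set V} (hΦ : IsRootSystem Φ) {w : V ≃ₗᵢ[ℝ] V}
    (hw : w ∈ reflGroup Φ) {α : V} (hα : α ∈ Φ) : w α ∈ Φ := by
  rw [reflGroup] at hw
  induction hw using Subgroup.closure_induction'' generalizing α with
  | one => exact hα
  | mem x hx => obtain ⟨β, hβ, rfl⟩ := hx; exact hΦ.refl_mem β hβ α hα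
  | inv_mem x hx =>
    obtain ⟨β, hβ, rfl⟩ := hx
    rw [refl_inv]; exact hΦ.refl_mem β hβ α hα
  | mul x y _ _ hx hy => exact hx (hy hα)

theorem IsRootSystem.finite_reflGroup [FiniteDimensional ℝ V] {Φ : Set V}
    (hΦ : IsRootSystem Φ) : (reflGroup Φ : Set (V ≃ₗᵢ[ℝ] V)).Finite := by
  have hfin : Finite Φ := hΦ.finite
  let r : (V ≃ₗᵢ[ℝ] V) → (Φ → V) := fun w α => w α
  have hpi : (Set.pi Set.univ fun _ : Φ => Φ).Finite := Set.Finite.pi fun _ => hΦ.finite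
  refine Set.Finite.of_injOn (f := r) (t := Set.pi Set.univ fun _ : Φ => Φ) ?_ ?_ hpi
  · intro w hw α _
    exact hΦ.map_mem hw α.2
  · intro w hw w' hw' h
    ext v
    obtain ⟨y, hy, z, hz, rfl⟩ := (Submodule.span ℝ Φ).exists_add_mem_mem_orthogonal v
    have hz' : ∀ α ∈ Φ, ⟪z, α⟫_ℝ = 0 := fun α hα =>
      (Submodule.mem_orthogonal' _ _).1 hz α (Submodule.subset_span hα)
    rw [map_add, map_add, apply_eq_of_mem_reflGroup hw hz', apply_eq_of_mem_reflGroup hw' hz']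
    congr 1
    have : Set.EqOn w.toLinearMap w'.toLinearMap Φ := fun α hα => congrFun h ⟨α, hα⟩
    exact LinearMap.eqOn_span this hy

/-! ### Nonnegative spans -/

theorem inner_nonneg_of_mem_span {A : Set V} {v β : V} (hv : ∀ α ∈ A, 0 ≤ ⟪v, α⟫_ℝ)
    (hβ : β ∈ Submodule.span ℝ≥0 A) : 0 ≤ ⟪v, β⟫_ℝ := by
  induction hβ using Submodule.span_induction with
  | mem x hx => exact hv x hx
  | zero => simp
  | add x y _ _ hx hy => rw [inner_add_right]; exact add_nonneg hx hy
  | smul a x _ hx =>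
    change 0 ≤ ⟪v, (a : ℝ) • x⟫_ℝ
    rw [inner_smul_right]; exact mul_nonneg a.2 hx

theorem eq_zero_or_inner_pos_of_mem_span {A : Set V} {v β : V} (hv : ∀ α ∈ A, 0 < ⟪v, α⟫_ℝ)
    (hβ : β ∈ Submodule.span ℝ≥0 A) : β = 0 ∨ 0 < ⟪v, β⟫_ℝ := by
  induction hβ using Submodule.span_induction with
  | mem x hx => exact .inr (hv x hx)
  | zero => simp
  | add x y _ _ hx hy =>
    rw [inner_add_right]
    rcases hx with rfl | hx <;> rcases hy with rfl | hy
    · simp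
    · right; simpa using hy
    · right; simpa using hx
    · right; exact add_pos hx hy
  | smul a x _ hx =>
    change (a : ℝ) • x = 0 ∨ 0 < ⟪v, (a : ℝ) • x⟫_ℝ
    rw [inner_smul_right]
    rcases hx with rfl | hx
    · simp
    · rcases a.2.eq_or_lt with h | h
      · left
        have h0 : (a : ℝ) = 0 := h.symm
        rw [h0, zero_smul]
      · right; exact mul_pos h hx

theorem mem_span_real_of_mem_span {A : Set V} {β : V} (h : β ∈ Submodule.span ℝ≥0 A) :
    β ∈ Submodule.span ℝ A :=
  Submodule.span_le_restrictScalars ℝ≥0 ℝ A h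

theorem map_mem_span_image {A : Set V} (w : V ≃ₗᵢ[ℝ] V) {β : V}
    (h : β ∈ Submodule.span ℝ≥0 A) : w β ∈ Submodule.span ℝ≥0 (w '' A) := by
  induction h using Submodule.span_induction with
  | mem x hx => exact Submodule.subset_span ⟨x, hx, rfl⟩
  | zero => simp
  | add x y _ _ hx hy => rw [map_add]; exact add_mem hx hy
  | smul a x _ hx =>
    change w ((a : ℝ) • x) ∈ _
    rw [map_smul]
    exact Submodule.smul_mem _ a hx

/-- Linearly independent vectors can be paired arbitrarily with a vector of the space. -/
theorem exists_inner_eq [FiniteDimensional ℝ V] {A : Set V} (hA : LinearIndepOn ℝ id A)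
    (f : V → ℝ) : ∃ v : V, ∀ α ∈ A, ⟪v, α⟫_ℝ = f α := by
  let b := Module.Basis.extend hA
  let φ : V →ₗ[ℝ] ℝ := b.constr ℝ fun x => f x
  refine ⟨(InnerProductSpace.toDual ℝ V).symm (LinearMap.toContinuousLinearMap φ), fun α hα => ?_⟩
  rw [InnerProductSpace.toDual_symm_apply]
  have h := b.constr_basis ℝ (fun x => f x) ⟨α, LinearIndepOn.subset_extend hA _ hα⟩
  rw [Module.Basis.extend_apply_self] at h
  exact h

theorem exists_inner_pos [FiniteDimensional ℝ V] {A : Set V} (hA : LinearIndepOn ℝ id A) :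
    ∃ v : V, ∀ α ∈ A, 0 < ⟪v, α⟫_ℝ := by
  obtain ⟨v, hv⟩ := exists_inner_eq hA 1
  exact ⟨v, fun α hα => by simp [hv α hα]⟩

theorem mem_span_of_mem_span_real [FiniteDimensional ℝ V] {A B : Set V}
    (hA : LinearIndepOn ℝ id A) (hBA : B ⊆ A) {β : V} (h : β ∈ Submodule.span ℝ≥0 A)
    (hB : β ∈ Submodule.span ℝ B) : β ∈ Submodule.span ℝ≥0 B := by
  have hu : A = B ∪ A \ B := (Set.union_sdiff_cancel hBA).symm
  rw [hu, Submodule.span_union, Submodule.mem_sup] at h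
  obtain ⟨y, hy, z, hz, rfl⟩ := h
  classical
  obtain ⟨v, hv⟩ := exists_inner_eq hA fun α => if α ∈ B then 0 else 1
  have hvB : ∀ x ∈ Submodule.span ℝ B, ⟪v, x⟫_ℝ = 0 := fun x hx => by
    induction hx using Submodule.span_induction with
    | mem x hx => rw [hv x (hBA hx), if_pos hx]
    | zero => simp
    | add x y _ _ hx hy => rw [inner_add_right, hx, hy, add_zero]
    | smul a x _ hx => rw [inner_smul_right, hx, mul_zero]
  have hvz : ∀ α ∈ A \ B, 0 < ⟪v, α⟫_ℝ := fun α hα => by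
    rw [hv α hα.1, if_neg hα.2]; exact one_pos
  rcases eq_zero_or_inner_pos_of_mem_span hvz hz with rfl | h
  · simpa using hy
  · have h1 := hvB _ hB
    rw [inner_add_right, hvB _ (mem_span_real_of_mem_span hy)] at h1
    linarith

/-! ### Simple subsystems -/

/-- A linearly independent set `Λ` of roots such that each root of `W_Λ` is a nonnegative or a
nonpositive combination of `Λ`. -/
structure IsBase (Φ Λ : Set V) : Prop where
  subset : Λ ⊆ Φ
  linearIndep : LinearIndepOn ℝ id Λ
  mem_or_neg_mem : ∀ β ∈ rootsOf Φ (reflGroup Λ),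
    β ∈ Submodule.span ℝ≥0 Λ ∨ -β ∈ Submodule.span ℝ≥0 Λ

theorem IsSimpleSubsystem.isBase {Φ Γ : Set V} (h : IsSimpleSubsystem Φ Γ) : IsBase Φ Γ := by
  obtain ⟨_, ⟨A, hA, rfl⟩, hΓ⟩ := h
  refine ⟨fun α hα => (hΓ.subset hα).1, hΓ.linearIndep, fun β hβ => ?_⟩
  have hle : reflGroup Γ ≤ reflGroup A := by
    rw [reflGroup, Subgroup.closure_le]
    rintro _ ⟨α, hα, rfl⟩
    exact (hΓ.subset hα).2
  have hβ' : β ∈ rootsOf Φ (reflGroup A) := ⟨hβ.1, hle hβ.2⟩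
  rw [hΓ.union_eq] at hβ'
  rcases hβ' with h | h
  · exact .inl h.2
  · exact .inr h.2

variable {Φ Λ : Set V}

theorem IsBase.reflGroup_le (hΛ : IsBase Φ Λ) : reflGroup Λ ≤ reflGroup Φ :=
  reflGroup_mono hΛ.subset

/-- A root whose reflection lies in `W_A` is in the linear span of `A`. -/
theorem mem_span_of_refl_mem [FiniteDimensional ℝ V] {A : Set V} {β : V}
    (h : refl β ∈ reflGroup A) : β ∈ Submodule.span ℝ A := by
  rw [← (Submodule.span ℝ A).orthogonal_orthogonal, Submodule.mem_orthogonal]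
  intro v hv
  exact inner_eq_zero_of_refl (apply_eq_of_mem_reflGroup h fun α hα =>
    (Submodule.mem_orthogonal' _ _).1 hv α (Submodule.subset_span hα))

theorem IsBase.mono [FiniteDimensional ℝ V] (hΛ : IsBase Φ Λ) {Δ : Set V} (h : Δ ⊆ Λ) :
    IsBase Φ Δ := by
  refine ⟨h.trans hΛ.subset, hΛ.linearIndep.mono h, fun β hβ => ?_⟩
  have hs := mem_span_of_refl_mem hβ.2
  rcases hΛ.mem_or_neg_mem β ⟨hβ.1, reflGroup_mono h hβ.2⟩ with h' | h'
  · exact .inl (mem_span_of_mem_span_real hΛ.linearIndep h h' hs)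
  · exact .inr (mem_span_of_mem_span_real hΛ.linearIndep h h' (neg_mem hs))

theorem IsBase.image (hΦ : IsRootSystem Φ) (hΛ : IsBase Φ Λ) {w : V ≃ₗᵢ[ℝ] V}
    (hw : w ∈ reflGroup Φ) : IsBase Φ (w '' Λ) := by
  refine ⟨?_, ?_, fun β hβ => ?_⟩
  · rintro _ ⟨α, hα, rfl⟩
    exact hΦ.map_mem hw (hΛ.subset hα)
  · exact LinearIndepOn.id_image
      (LinearIndepOn.map_injOn (f := w.toLinearMap) hΛ.linearIndep w.injective.injOn)
  · have h1 : refl (w⁻¹ β) ∈ reflGroup Λ := by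
      rw [refl_map, inv_inv]
      exact conj_mem_of_mem_reflGroup_image w hβ.2
    have h2 := hΛ.mem_or_neg_mem (w⁻¹ β) ⟨hΦ.map_mem (inv_mem hw) hβ.1, h1⟩
    refine h2.imp (fun h => ?_) (fun h => ?_)
    · simpa [apply_inv_apply] using map_mem_span_image w h
    · simpa [apply_inv_apply] using map_mem_span_image w h

theorem IsBase.map_mem_rootsOf (hΦ : IsRootSystem Φ) (hΛ : IsBase Φ Λ) {w : V ≃ₗᵢ[ℝ] V}
    (hw : w ∈ reflGroup Λ) {β : V} (hβ : β ∈ rootsOf Φ (reflGroup Λ)) :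
    w β ∈ rootsOf Φ (reflGroup Λ) := by
  refine ⟨hΦ.map_mem (hΛ.reflGroup_le hw) hβ.1, ?_⟩
  rw [refl_map]
  exact mul_mem (mul_mem hw hβ.2) (inv_mem hw)

theorem IsBase.mem_rootsOf (hΛ : IsBase Φ Λ) {α : V} (hα : α ∈ Λ) :
    α ∈ rootsOf Φ (reflGroup Λ) := ⟨hΛ.subset hα, refl_mem_reflGroup hα⟩

/-- A positive root made negative by a simple reflection is the corresponding simple root. -/
theorem IsBase.eq_of_refl_neg [FiniteDimensional ℝ V] (hΦ : IsRootSystem Φ) (hΛ : IsBase Φ Λ)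
    {γ β : V} (hγ : γ ∈ Λ) (hβ : β ∈ Φ) (hpos : β ∈ Submodule.span ℝ≥0 Λ)
    (hneg : -refl γ β ∈ Submodule.span ℝ≥0 Λ) : β = γ := by
  obtain ⟨c, hc⟩ : ∃ c : ℝ, β = c • γ := by
    rw [refl_apply] at hneg
    generalize 2 * ⟪β, γ⟫_ℝ / ⟪γ, γ⟫_ℝ = t at hneg
    have hins : insert γ (Λ \ {γ}) = Λ := by simp [hγ]
    rw [← hins, Submodule.mem_span_insert] at hpos hneg
    obtain ⟨c, a, ha, hβa⟩ := hpos
    obtain ⟨c', a', ha', hβa'⟩ := hneg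
    have hβa2 : β = (c : ℝ) • γ + a := hβa
    have hβa2' : -(β - t • γ) = (c' : ℝ) • γ + a' := hβa'
    have hsum : a + a' = (t - c - c') • γ := by
      rw [hβa2] at hβa2'
      rw [sub_smul, sub_smul]
      have : a' = -((c : ℝ) • γ + a - t • γ) - (c' : ℝ) • γ := by rw [hβa2']; abel
      rw [this]; abel
    classical
    obtain ⟨y, hy⟩ := exists_inner_eq hΛ.linearIndep fun α => if α = γ then 0 else 1
    have hy' : ∀ α ∈ Λ \ {γ}, 0 < ⟪y, α⟫_ℝ := fun α hα => by
      rw [hy α hα.1, if_neg (by simpa using hα.2)]; exact one_pos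
    have h0 : ⟪y, a + a'⟫_ℝ = 0 := by
      rw [hsum, inner_smul_right, hy γ hγ, if_pos rfl, mul_zero]
    rw [inner_add_right] at h0
    have h1' := inner_nonneg_of_mem_span (fun α hα => (hy' α hα).le) ha'
    rcases eq_zero_or_inner_pos_of_mem_span hy' ha with rfl | h1
    · exact ⟨c, by rw [hβa2, add_zero]⟩
    · linarith
  rcases hΦ.reduced γ (hΛ.subset hγ) c (hc ▸ hβ) with rfl | rfl
  · simpa using hc
  · exfalso
    obtain ⟨v, hv⟩ := exists_inner_pos hΛ.linearIndep
    have h1 := inner_nonneg_of_mem_span (fun α hα => (hv α hα).le) hpos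
    have h2 := hv γ hγ
    rw [hc, inner_smul_right] at h1
    linarith

theorem IsBase.exchange [FiniteDimensional ℝ V] (hΦ : IsRootSystem Φ) (hΛ : IsBase Φ Λ)
    {α : V} (hα : α ∈ Λ) (l : List V) (hl : ∀ γ ∈ l, γ ∈ Λ)
    (hneg : -(l.map refl).prod α ∈ Submodule.span ℝ≥0 Λ) :
    ∃ l' : List V, (∀ γ ∈ l', γ ∈ Λ) ∧ l'.length < l.length ∧
      (l'.map refl).prod = (l.map refl).prod * refl α := by
  induction l with
  | nil =>
    exfalso
    obtain ⟨v, hv⟩ := exists_inner_pos hΛ.linearIndep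
    have h1 := inner_nonneg_of_mem_span (fun α hα => (hv α hα).le) hneg
    have h2 := hv α hα
    simp only [List.map_nil, List.prod_nil, inner_neg_right] at h1
    change 0 ≤ -⟪v, α⟫_ℝ at h1
    linarith
  | cons γ l ih =>
    have hl' : ∀ γ ∈ l, γ ∈ Λ := fun δ hδ => hl δ (List.mem_cons_of_mem _ hδ)
    have hγ : γ ∈ Λ := hl γ List.mem_cons_self
    have hmem : (l.map refl).prod ∈ reflGroup Λ := by
      refine Subgroup.list_prod_mem _ fun x hx => ?_
      obtain ⟨δ, hδ, rfl⟩ := List.mem_map.1 hx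
      exact refl_mem_reflGroup (hl' δ hδ)
    have hroot := hΛ.map_mem_rootsOf hΦ hmem (hΛ.mem_rootsOf hα)
    rcases hΛ.mem_or_neg_mem _ hroot with hpos | hn
    · refine ⟨l, hl', by simp, ?_⟩
      have hne : -refl γ ((l.map refl).prod α) ∈ Submodule.span ℝ≥0 Λ := by simpa using hneg
      have heq := hΛ.eq_of_refl_neg hΦ hγ hroot.1 hpos hne
      have := refl_map (l.map refl).prod α
      rw [heq] at this
      rw [List.map_cons, List.prod_cons, this]
      have h2 := refl_mul_self α
      calc _ = (l.map refl).prod * 1 := (mul_one _).symm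
        _ = _ := by rw [← h2]; group
    · obtain ⟨l', h1, h2, h3⟩ := ih hl' hn
      refine ⟨γ :: l', ?_, by simpa using h2, ?_⟩
      · intro δ hδ
        rcases List.mem_cons.1 hδ with rfl | hδ
        · exact hγ
        · exact h1 δ hδ
      · simp [h3, mul_assoc]

/-- If `x` and `w x` are both dominant, `w ∈ W_Λ`, then `w` lies in the group generated by the
simple reflections fixing `x`. -/
theorem IsBase.mem_reflGroup_of_dominant [FiniteDimensional ℝ V] (hΦ : IsRootSystem Φ)
    (hΛ : IsBase Φ Λ) {w : V ≃ₗᵢ[ℝ] V} (hw : w ∈ reflGroup Λ) {x : V}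
    (hx : ∀ α ∈ Λ, 0 ≤ ⟪x, α⟫_ℝ) (hwx : ∀ α ∈ Λ, 0 ≤ ⟪w x, α⟫_ℝ) :
    w ∈ reflGroup {α ∈ Λ | ⟪x, α⟫_ℝ = 0} := by
  obtain ⟨l, hl, rfl⟩ : ∃ l : List V, (∀ γ ∈ l, γ ∈ Λ) ∧ (l.map refl).prod = w := by
    clear hwx
    rw [reflGroup] at hw
    induction hw using Subgroup.closure_induction'' with
    | one => exact ⟨[], by simp⟩
    | mem x hx => obtain ⟨α, hα, rfl⟩ := hx; exact ⟨[α], by simpa using hα, by simp⟩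
    | inv_mem x hx =>
      obtain ⟨α, hα, rfl⟩ := hx
      exact ⟨[α], by simpa using hα, by simp [refl_inv]⟩
    | mul x y _ _ hx hy =>
      obtain ⟨l, hl, rfl⟩ := hx
      obtain ⟨l', hl', rfl⟩ := hy
      exact ⟨l ++ l', fun γ hγ => (List.mem_append.1 hγ).elim (hl γ) (hl' γ), by simp⟩
  clear hw
  induction hk : l.length using Nat.strong_induction_on generalizing l with
  | _ k ih =>
    rcases l.eq_nil_or_concat with rfl | ⟨l, α, rfl⟩
    · exact one_mem _
    · rw [List.concat_eq_append] at *
      have hl' : ∀ γ ∈ l, γ ∈ Λ := fun δ hδ => hl δ (by simp [hδ])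
      have hα : α ∈ Λ := hl α (by simp)
      have hmem : (l.map refl).prod ∈ reflGroup Λ := by
        refine Subgroup.list_prod_mem _ fun x hx => ?_
        obtain ⟨δ, hδ, rfl⟩ := List.mem_map.1 hx
        exact refl_mem_reflGroup (hl' δ hδ)
      have hlen : l.length < k := by simp at hk; omega
      have hprod : ((l ++ [α]).map refl).prod = (l.map refl).prod * refl α := by simp
      rw [hprod] at hwx ⊢
      rcases hΛ.mem_or_neg_mem _ (hΛ.map_mem_rootsOf hΦ hmem (hΛ.mem_rootsOf hα)) with h | h
      · have h0 := inner_nonneg_of_mem_span hwx h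
        change 0 ≤ ⟪(l.map refl).prod (refl α x), (l.map refl).prod α⟫_ℝ at h0
        rw [LinearIsometryEquiv.inner_map_map] at h0
        have h1 : ⟪refl α x, α⟫_ℝ = -⟪x, α⟫_ℝ := by
          rw [← (refl α).inner_map_map x α, refl_self, inner_neg_right, neg_neg]
        have h2 := hx α hα
        have h3 : ⟪x, α⟫_ℝ = 0 := by linarith
        refine mul_mem (ih _ hlen l hl' ?_ rfl) (refl_mem_reflGroup ⟨hα, h3⟩)
        intro δ hδ
        have := hwx δ hδ
        change 0 ≤ ⟪(l.map refl).prod (refl α x), δ⟫_ℝ at this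
        rwa [refl_of_inner_eq_zero h3] at this
      · obtain ⟨l', h1, h2, h3⟩ := hΛ.exchange hΦ hα l hl' h
        rw [← h3] at hwx ⊢
        exact ih _ (h2.trans hlen) l' h1 hwx rfl

theorem IsBase.exists_dominant [FiniteDimensional ℝ V] (hΦ : IsRootSystem Φ) (hΛ : IsBase Φ Λ)
    (v : V) : ∃ w ∈ reflGroup Λ, ∀ α ∈ Λ, 0 ≤ ⟪w⁻¹ v, α⟫_ℝ := by
  obtain ⟨ρ, hρ⟩ := exists_inner_pos hΛ.linearIndep
  have hfin : (reflGroup Λ : Set (V ≃ₗᵢ[ℝ] V)).Finite :=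
    hΦ.finite_reflGroup.subset hΛ.reflGroup_le
  obtain ⟨w, hw, hmax⟩ := Set.exists_max_image _ (fun w : V ≃ₗᵢ[ℝ] V => ⟪w⁻¹ v, ρ⟫_ℝ) hfin
    ⟨1, one_mem _⟩
  refine ⟨w, hw, fun α hα => ?_⟩
  have h := hmax (w * refl α) (mul_mem hw (refl_mem_reflGroup hα))
  rw [mul_inv_rev, refl_inv] at h
  change ⟪refl α (w⁻¹ v), ρ⟫_ℝ ≤ _ at h
  rw [refl_apply, inner_sub_left, real_inner_smul_left] at h
  have h1 := hρ α hα
  rw [real_inner_comm] at h1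
  have h2 : 0 < ⟪α, α⟫_ℝ := by
    rw [real_inner_self_pos]
    rintro rfl
    simp at h1
  by_contra! hneg
  have : 2 * ⟪w⁻¹ v, α⟫_ℝ / ⟪α, α⟫_ℝ < 0 := div_neg_of_neg_of_pos (by linarith) h2
  have := mul_neg_of_neg_of_pos this h1
  linarith

/-- The closed facet `{v | ⟨v, Γ⟩ ≥ 0, ⟨v, Δ⟩ = 0}` is covered by suitable `W_Λ`-facets. -/
theorem exists_mem_facet [FiniteDimensional ℝ V] (hΦ : IsRootSystem Φ) (hΛ : IsBase Φ Λ)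
    {Γ Δ : Set V} (hΓ : IsBase Φ Γ) (hΓΛ : reflGroup Γ ≤ reflGroup Λ) (hΔ : Δ ⊆ Γ) {v : V}
    (hv : ∀ α ∈ Γ, 0 ≤ ⟪v, α⟫_ℝ) (hv0 : ∀ α ∈ Δ, ⟪v, α⟫_ℝ = 0) :
    ∃ w ∈ cosetReps Φ Γ Λ, ∃ Δ' ⊆ Λ, w⁻¹ v ∈ facet Λ Δ' ∧
      reflGroup Δ ≤ reflGroup (w '' Δ') := by
  obtain ⟨ρ, hρ⟩ := exists_inner_pos hΓ.linearIndep
  have hroots : ∀ w ∈ reflGroup Λ, ∀ α ∈ Γ, w⁻¹ α ∈ rootsOf Φ (reflGroup Λ) := fun w hw α hα =>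
    hΛ.map_mem_rootsOf hΦ (inv_mem hw) ⟨hΓ.subset hα, hΓΛ (refl_mem_reflGroup hα)⟩
  let K : Set V := ⋃ w ∈ cosetReps Φ Γ Λ, {x | ∀ α ∈ Λ, 0 ≤ ⟪w⁻¹ x, α⟫_ℝ}
  have hfin : (cosetReps Φ Γ Λ).Finite :=
    hΦ.finite_reflGroup.subset fun w hw => hΛ.reflGroup_le hw.1
  have hK : IsClosed K := by
    refine hfin.isClosed_biUnion fun w _ => ?_
    simp only [Set.ofPred_forall]
    refine isClosed_biInter fun α _ => ?_
    exact isClosed_le continuous_const ((w⁻¹).continuous.inner continuous_const)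
  have hKε : ∀ ε : ℝ, 0 < ε → v + ε • ρ ∈ K := by
    intro ε hε
    obtain ⟨w, hw, hdom⟩ := hΛ.exists_dominant hΦ (v + ε • ρ)
    refine Set.mem_biUnion (x := w) ⟨hw, ?_⟩ hdom
    rintro _ ⟨α, hα, rfl⟩
    refine ⟨hroots w hw α hα, ?_⟩
    rcases hΛ.mem_or_neg_mem _ (hroots w hw α hα) with h | h
    · exact h
    · exfalso
      have h1 := inner_nonneg_of_mem_span hdom h
      rw [inner_neg_right, LinearIsometryEquiv.inner_map_map, inner_add_left,
        real_inner_smul_left] at h1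
      have h2 := hv α hα
      have h3 := mul_pos hε (hρ α hα)
      linarith
  have hvK : v ∈ K := by
    have ht : Filter.Tendsto (fun ε : ℝ => v + ε • ρ) (nhdsWithin 0 (Set.Ioi 0)) (nhds v) := by
      have : Continuous fun ε : ℝ => v + ε • ρ := by fun_prop
      have h := this.tendsto 0
      rw [zero_smul, add_zero] at h
      exact h.mono_left nhdsWithin_le_nhds
    refine hK.mem_of_tendsto ht ?_
    filter_upwards [self_mem_nhdsWithin] with ε hε using hKε ε hε
  obtain ⟨w, hw, hdom⟩ := Set.mem_iUnion₂.1 hvK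
  refine ⟨w, hw, {α ∈ Λ | ⟪w⁻¹ v, α⟫_ℝ = 0}, fun α hα => hα.1, ⟨?_, fun α hα => hα.2⟩, ?_⟩
  · intro α hα
    exact (hdom α hα.1).lt_of_ne fun h => hα.2 ⟨hα.1, h.symm⟩
  · rw [reflGroup, Subgroup.closure_le]
    rintro _ ⟨α, hα, rfl⟩
    have hfix : refl (w⁻¹ α) (w⁻¹ v) = w⁻¹ v :=
      refl_of_inner_eq_zero (by rw [LinearIsometryEquiv.inner_map_map, hv0 α hα])
    have h := hΛ.mem_reflGroup_of_dominant hΦ (hroots w hw.1 α (hΔ hα)).2 hdom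
      (by rw [hfix]; exact hdom)
    have h' := conj_mem_reflGroup_image w h
    rwa [← refl_map, apply_inv_apply] at h'

/-! ### Strata and their closures -/

variable {n : ℕ}

/-- The set defined by the weak inequalities corresponding to `stdStratum c`. -/
def closedStratum (c : Fin (n + 1) → Set V) : Set (Fin n → V) :=
  {v | ∀ i : Fin n, (∀ α ∈ c i.castSucc, 0 ≤ ⟪v i, α⟫_ℝ) ∧ ∀ α ∈ c i.succ, ⟪v i, α⟫_ℝ = 0}

theorem facet_image (w : V ≃ₗᵢ[ℝ] V) {Γ Δ : Set V} {x : V} :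
    w x ∈ facet (w '' Γ) (w '' Δ) ↔ x ∈ facet Γ Δ := by
  rw [facet, facet, ← Set.image_sdiff w.injective]
  simp only [Set.mem_ofPred_eq, Set.forall_mem_image, LinearIsometryEquiv.inner_map_map]

theorem diag_image_stdStratum (u : V ≃ₗᵢ[ℝ] V) (c : Fin (n + 1) → Set V) :
    diag n u '' stdStratum c = stdStratum fun i => u '' c i := by
  ext v
  constructor
  · rintro ⟨x, hx, rfl⟩ i
    exact (facet_image u).2 (hx i)
  · intro hv
    refine ⟨diag n u⁻¹ v, fun i => ?_, funext fun i => apply_inv_apply u (v i)⟩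
    rw [← facet_image u]
    change u (u⁻¹ (v i)) ∈ _
    rw [apply_inv_apply]
    exact hv i

theorem facet_nonneg {Γ Δ : Set V} {v α : V} (hv : v ∈ facet Γ Δ) (hα : α ∈ Γ) :
    0 ≤ ⟪v, α⟫_ℝ := by
  by_cases h : α ∈ Δ
  · exact (hv.2 α h).ge
  · exact (hv.1 α ⟨hα, h⟩).le

/-- `Δ` is recovered from any point of `𝒞_{Γ,Δ}`. -/
theorem eq_of_mem_facet {Γ Δ : Set V} (h : Δ ⊆ Γ) {v : V} (hv : v ∈ facet Γ Δ) :
    {α ∈ Γ | ⟪v, α⟫_ℝ = 0} = Δ := by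
  ext α
  constructor
  · rintro ⟨hα, h0⟩
    by_contra hΔ
    exact (hv.1 α ⟨hα, hΔ⟩).ne' h0
  · intro hα
    exact ⟨h hα, hv.2 α hα⟩

theorem stdStratum_nonempty [FiniteDimensional ℝ V] {c : Fin (n + 1) → Set V} (hc : Antitone c)
    (hli : LinearIndepOn ℝ id (c 0)) : (stdStratum c).Nonempty := by
  classical
  choose v hv using fun i : Fin n =>
    exists_inner_eq hli fun α => if α ∈ c i.succ then (0 : ℝ) else 1
  refine ⟨v, fun i => ⟨fun α hα => ?_, fun α hα => ?_⟩⟩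
  · rw [hv i α (hc (Fin.zero_le _) hα.1), if_neg hα.2]
    exact one_pos
  · rw [hv i α (hc (Fin.zero_le _) hα), if_pos hα]

theorem add_smul_mem_stdStratum {c : Fin (n + 1) → Set V} {x f : Fin n → V}
    (hx : x ∈ closedStratum c) (hf : f ∈ stdStratum c) {ε : ℝ} (hε : 0 < ε) :
    x + ε • f ∈ stdStratum c := by
  refine fun i => ⟨fun α hα => ?_, fun α hα => ?_⟩ <;>
    simp only [Pi.add_apply, Pi.smul_apply, inner_add_left, real_inner_smul_left]
  · exact add_pos_of_nonneg_of_pos ((hx i).1 α hα.1) (mul_pos hε ((hf i).1 α hα))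
  · rw [(hx i).2 α hα, (hf i).2 α hα, mul_zero, add_zero]

theorem closure_stdStratum [FiniteDimensional ℝ V] {c : Fin (n + 1) → Set V} (hc : Antitone c)
    (hli : LinearIndepOn ℝ id (c 0)) : closure (stdStratum c) = closedStratum c := by
  apply Set.Subset.antisymm
  · refine closure_minimal (fun v hv i => ⟨fun α hα => facet_nonneg (hv i) hα, (hv i).2⟩) ?_
    simp only [closedStratum, Set.ofPred_forall, Set.ofPred_and]
    refine isClosed_iInter fun i => ?_
    refine (isClosed_biInter fun α _ => ?_).inter (isClosed_biInter fun α _ => ?_)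
    · exact isClosed_le continuous_const (by fun_prop)
    · exact isClosed_eq (by fun_prop) continuous_const
  · intro v hv
    obtain ⟨f, hf⟩ := stdStratum_nonempty hc hli
    have ht : Filter.Tendsto (fun ε : ℝ => v + ε • f) (nhdsWithin 0 (Set.Ioi 0)) (nhds v) := by
      have : Continuous fun ε : ℝ => v + ε • f := by fun_prop
      have h := this.tendsto 0
      rw [zero_smul, add_zero] at h
      exact h.mono_left nhdsWithin_le_nhds
    refine mem_closure_of_tendsto ht ?_
    filter_upwards [self_mem_nhdsWithin] with ε hε using add_smul_mem_stdStratum hv hf hε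

/-- A stratum is relatively open in its linear span. -/
theorem exists_sub_smul_mem_stdStratum {c : Fin (n + 1) → Set V} (hc : ∀ i, (c i).Finite)
    {x f : Fin n → V} (hx : x ∈ stdStratum c) (hf : f ∈ Submodule.span ℝ (stdStratum c)) :
    ∃ ε : ℝ, 0 < ε ∧ x - ε • f ∈ stdStratum c := by
  have hf0 : ∀ i : Fin n, ∀ α ∈ c i.succ, ⟪f i, α⟫_ℝ = 0 := by
    intro i α hα
    induction hf using Submodule.span_induction with
    | mem x hx => exact (hx i).2 α hα
    | zero => simp
    | add x y _ _ hx hy => rw [Pi.add_apply, inner_add_left, hx, hy, add_zero]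
    | smul a x _ hx => rw [Pi.smul_apply, real_inner_smul_left, hx, mul_zero]
  have hev : ∀ᶠ ε : ℝ in nhdsWithin 0 (Set.Ioi 0),
      ∀ i : Fin n, ∀ α ∈ c i.castSucc \ c i.succ, 0 < ⟪(x - ε • f) i, α⟫_ℝ := by
    rw [Filter.eventually_all]
    intro i
    rw [Filter.eventually_all_finite ((hc _).sdiff)]
    intro α hα
    have hcont : Continuous fun ε : ℝ => ⟪(x - ε • f) i, α⟫_ℝ := by fun_prop
    have h0 : (0 : ℝ) < ⟪(x - (0 : ℝ) • f) i, α⟫_ℝ := by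
      rw [zero_smul, sub_zero]; exact (hx i).1 α hα
    exact (hcont.tendsto 0).mono_left nhdsWithin_le_nhds (lt_mem_nhds h0)
  obtain ⟨ε, hε, hpos⟩ := (hev.and self_mem_nhdsWithin).exists
  refine ⟨ε, hpos, fun i => ⟨hε i, fun α hα => ?_⟩⟩
  rw [Pi.sub_apply, Pi.smul_apply, inner_sub_left, real_inner_smul_left, hf0 i α hα,
    (hx i).2 α hα, mul_zero, sub_zero]

/-- A stratum `𝒳_d` contained in the closure of `𝒳_c`, whose span meets `𝒳_c`, is contained
in `𝒳_c`. -/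
theorem stdStratum_subset_of_subset_closed {c d : Fin (n + 1) → Set V}
    (hd : ∀ i, (d i).Finite) (hsub : stdStratum d ⊆ closedStratum c) {f : Fin n → V}
    (hf : f ∈ stdStratum c) (hfd : f ∈ Submodule.span ℝ (stdStratum d)) :
    stdStratum d ⊆ stdStratum c := by
  intro x hx
  obtain ⟨ε, hε, h⟩ := exists_sub_smul_mem_stdStratum hd hx hfd
  have := add_smul_mem_stdStratum (hsub h) hf hε
  rwa [sub_add_cancel] at this

variable {Γ : Set V}

/-- Two strata `u(𝒳_c)`, `g(𝒳_d)` which meet are equal. -/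
theorem stratum_eq_of_inter [FiniteDimensional ℝ V] (hΦ : IsRootSystem Φ) (hΓ : IsBase Φ Γ)
    {c d : Fin (n + 1) → Set V} (hc : IsFlag Γ c) (hd : IsFlag Γ d) {u g : V ≃ₗᵢ[ℝ] V}
    (hu : u ∈ reflGroup Γ) (hg : g ∈ reflGroup Γ) {v : Fin n → V}
    (hvc : v ∈ diag n u '' stdStratum c) (hvd : v ∈ diag n g '' stdStratum d) :
    diag n u '' stdStratum c = diag n g '' stdStratum d := by
  obtain ⟨y, hy, rfl⟩ := hvc
  obtain ⟨x, hx, hxy⟩ := hvd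
  have hwx : ∀ i, (u⁻¹ * g) (x i) = y i := fun i => by
    have h : g (x i) = u (y i) := congrFun hxy i
    change u⁻¹ (g (x i)) = y i
    rw [h, inv_apply_apply]
  have key : ∀ i : Fin (n + 1), c i = d i ∧ u⁻¹ * g ∈ reflGroup (d i) := by
    intro i
    induction i using Fin.induction with
    | zero => rw [hc.1, hd.1]; exact ⟨rfl, mul_mem (inv_mem hu) hg⟩
    | succ i ih =>
      obtain ⟨hcd, hw⟩ := ih
      have hbase : IsBase Φ (d i.castSucc) :=
        hΓ.mono (hd.1 ▸ hd.2 (Fin.zero_le _))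
      have hxi := hx i
      have hyi := hy i
      have hmem : u⁻¹ * g ∈ reflGroup (d i.succ) := by
        have h := hbase.mem_reflGroup_of_dominant hΦ hw (fun α hα => facet_nonneg hxi hα)
          (fun α hα => by rw [hwx i]; exact facet_nonneg hyi (hcd ▸ hα))
        rwa [eq_of_mem_facet (hd.2 i.castSucc_le_succ) hxi] at h
      have hxy : x i = y i := by
        rw [← hwx i, apply_eq_of_mem_reflGroup hmem hxi.2]
      refine ⟨?_, hmem⟩
      rw [← eq_of_mem_facet (hd.2 i.castSucc_le_succ) hxi,
        ← eq_of_mem_facet (hc.2 i.castSucc_le_succ) hyi, hxy, hcd]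
  have hcd : c = d := funext fun i => (key i).1
  subst hcd
  refine Set.image_congr fun z hz => funext fun i => ?_
  have hz' : (u⁻¹ * g) (z i) = z i :=
    apply_eq_of_mem_reflGroup (key i.succ).2 (hz i).2
  change u (z i) = g (z i)
  rw [← hz']
  change u (u⁻¹ (g (z i))) = g ((u⁻¹ * g) (z i))
  rw [apply_inv_apply, hz']

theorem revProd_mul_inv_mem {d : Fin (n + 1) → Set V} (hd : Antitone d)
    {w : Fin n → (V ≃ₗᵢ[ℝ] V)}
    (hw : ∀ i : Fin n, w i ∈ reflGroup (revProd w i.castSucc '' d i.castSucc))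
    (i j : Fin (n + 1)) (hij : i ≤ j) :
    revProd w j * (revProd w i)⁻¹ ∈ reflGroup (revProd w i '' d i) := by
  induction j using Fin.induction with
  | zero =>
    obtain rfl : i = 0 := le_antisymm hij (Fin.zero_le _)
    rw [mul_inv_cancel]
    exact one_mem _
  | succ j ih =>
    rcases hij.eq_or_lt with rfl | hlt
    · rw [mul_inv_cancel]
      exact one_mem _
    · have hij' : i ≤ j.castSucc := Fin.le_castSucc_iff.2 hlt
      have hq := ih hij'
      rw [revProd_succ, mul_assoc]
      refine mul_mem ?_ hq
      have h1 := reflGroup_mono (Set.image_mono (hd hij')) (hw j)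
      rw [← reflGroup_image_of_mem hq, Set.image_image]
      convert h1 using 2
      refine Set.image_congr fun x _ => ?_
      change revProd w j.castSucc ((revProd w i)⁻¹ (revProd w i x)) = _
      rw [inv_apply_apply]

/-- The `i`-th component of a point of `w_n ⋯ w_1(𝒳_d)` only depends on `w_i ⋯ w_1`. -/
theorem revProd_last_apply {d : Fin (n + 1) → Set V} (hd : Antitone d)
    {w : Fin n → (V ≃ₗᵢ[ℝ] V)}
    (hw : ∀ i : Fin n, w i ∈ reflGroup (revProd w i.castSucc '' d i.castSucc))
    (i : Fin (n + 1)) {y : V} (hy : ∀ α ∈ d i, ⟪y, α⟫_ℝ = 0) :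
    revProd w (Fin.last n) y = revProd w i y := by
  have h := apply_eq_of_mem_reflGroup (revProd_mul_inv_mem hd hw i (Fin.last n) (Fin.le_last i))
    (v := revProd w i y) (by
      rintro _ ⟨α, hα, rfl⟩
      rw [LinearIsometryEquiv.inner_map_map, hy α hα])
  change revProd w (Fin.last n) ((revProd w i)⁻¹ (revProd w i y)) = _ at h
  rwa [inv_apply_apply] at h

theorem ClosureIndex.revProd_mem {c d : Fin (n + 1) → Set V} {w : Fin n → (V ≃ₗᵢ[ℝ] V)}
    (hd : IsFlag Λ d) (h : ClosureIndex Φ c w d) (i : Fin (n + 1)) :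
    revProd w i ∈ reflGroup Λ := by
  have := revProd_mul_inv_mem hd.2 (fun i => (h.1 i).1) 0 i (Fin.zero_le _)
  rw [revProd_zero, inv_one, mul_one, hd.1] at this
  simpa using this

theorem ClosureIndex.image_subset {c d : Fin (n + 1) → Set V} {w : Fin n → (V ≃ₗᵢ[ℝ] V)}
    (hd : IsFlag Λ d) (h : ClosureIndex Φ c w d) :
    diag n (revProd w (Fin.last n)) '' stdStratum d ⊆ closedStratum c := by
  rintro _ ⟨y, hy, rfl⟩ i
  have hyi := hy i
  have hval : diag n (revProd w (Fin.last n)) y i = revProd w i.succ (y i) :=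
    revProd_last_apply hd.2 (fun i => (h.1 i).1) i.succ hyi.2
  rw [hval]
  constructor
  · intro α hα
    have hpos : (w i)⁻¹ α ∈ Submodule.span ℝ≥0 (revProd w i.castSucc '' d i.castSucc) :=
      ((h.1 i).2 ⟨α, hα, rfl⟩).2
    have := inner_nonneg_of_mem_span (v := revProd w i.castSucc (y i)) (by
      rintro _ ⟨β, hβ, rfl⟩
      rw [LinearIsometryEquiv.inner_map_map]
      exact facet_nonneg hyi hβ) hpos
    rwa [inner_inv_apply] at this
  · intro α hα
    refine inner_eq_zero_of_refl
      (apply_eq_of_mem_reflGroup (h.2 i (refl_mem_reflGroup hα)) ?_)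
    rintro _ ⟨β, hβ, rfl⟩
    rw [LinearIsometryEquiv.inner_map_map, hyi.2 β hβ]

theorem revProd_cons (w₀ : V ≃ₗᵢ[ℝ] V) (w : Fin n → (V ≃ₗᵢ[ℝ] V)) (i : Fin (n + 1)) :
    revProd (Fin.cons w₀ w : Fin (n + 1) → (V ≃ₗᵢ[ℝ] V)) i.succ = revProd w i * w₀ := by
  induction i using Fin.induction with
  | zero => rfl
  | succ i ih =>
    rw [revProd_succ, Fin.cons_succ, ← Fin.succ_castSucc, ih, revProd_succ, mul_assoc]

theorem exists_closureIndex [FiniteDimensional ℝ V] (hΦ : IsRootSystem Φ) (hΛ : IsBase Φ Λ)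
    {c : Fin (n + 1) → Set V} (hc : Antitone c) (hc0 : IsBase Φ (c 0))
    (hle : reflGroup (c 0) ≤ reflGroup Λ) {v : Fin n → V} (hv : v ∈ closedStratum c) :
    ∃ (w : Fin n → (V ≃ₗᵢ[ℝ] V)) (d : Fin (n + 1) → Set V), IsFlag Λ d ∧ ClosureIndex Φ c w d ∧
      v ∈ diag n (revProd w (Fin.last n)) '' stdStratum d := by
  induction n generalizing Λ with
  | zero =>
    refine ⟨Fin.elim0, fun _ => Λ, ⟨rfl, antitone_const⟩, ⟨fun i => i.elim0, fun i => i.elim0⟩,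
      v, fun i => i.elim0, funext fun i => i.elim0⟩
  | succ n ih =>
    obtain ⟨w₀, hw₀, Δ, hΔ, hfacet, hgrp⟩ := exists_mem_facet hΦ hΛ hc0 hle
      (hc (Fin.zero_le (Fin.succ 0))) (hv 0).1 (hv 0).2
    have hw₀Φ := hΛ.reflGroup_le hw₀.1
    have hbase : IsBase Φ (w₀ '' Δ) := (hΛ.mono hΔ).image hΦ hw₀Φ
    obtain ⟨w, d, hd, hidx, y, hy, hyv⟩ := ih (Λ := w₀ '' Δ) (c := fun i => c i.succ)
      hbase (fun i j hij => hc (Fin.succ_le_succ_iff.2 hij))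
      (hc0.mono (hc (Fin.zero_le _))) hgrp (v := fun i => v i.succ) (fun i => hv i.succ)
    have himg : ∀ i : Fin (n + 1), revProd (Fin.cons w₀ w : Fin (n + 1) → (V ≃ₗᵢ[ℝ] V)) i.succ ''
        (⇑w₀⁻¹ '' d i) = revProd w i '' d i := fun i => by
      rw [revProd_cons, Set.image_image]
      refine Set.image_congr fun x _ => ?_
      change revProd w i (w₀ (w₀⁻¹ x)) = _
      rw [apply_inv_apply]
    refine ⟨Fin.cons w₀ w, Fin.cons Λ fun i => ⇑w₀⁻¹ '' d i, ⟨rfl, ?_⟩, ⟨?_, ?_⟩,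
      Fin.cons (w₀⁻¹ (v 0)) (diag n w₀⁻¹ y), ?_, ?_⟩
    · have h0 : ∀ i, ⇑w₀⁻¹ '' d i ⊆ Λ := fun i => by
        have h1 : d i ⊆ w₀ '' Δ := hd.1 ▸ hd.2 (Fin.zero_le i)
        exact ((Set.image_mono h1).trans (image_inv_image w₀ Δ).subset).trans hΔ
      refine Fin.antitone_iff_succ_le.2 fun i => ?_
      cases i using Fin.cases with
      | zero => exact h0 0
      | succ i =>
        rw [← Fin.succ_castSucc, Fin.cons_succ, Fin.cons_succ]
        exact Set.image_mono (hd.2 i.castSucc_le_succ)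
    · intro i
      cases i using Fin.cases with
      | zero =>
        rw [Fin.castSucc_zero, revProd_zero, Fin.cons_zero, Fin.cons_zero]
        simpa using hw₀
      | succ i =>
        rw [← Fin.succ_castSucc, Fin.cons_succ, Fin.cons_succ, himg]
        exact hidx.1 i
    · intro i
      rw [Fin.cons_succ, himg]
      cases i using Fin.cases with
      | zero =>
        rw [revProd_zero, hd.1]
        simpa using hgrp
      | succ i => exact hidx.2 i
    · intro i
      cases i using Fin.cases with
      | zero =>
        have h : ⇑w₀⁻¹ '' d 0 = Δ := by rw [hd.1, image_inv_image]
        change w₀⁻¹ (v 0) ∈ facet Λ (⇑w₀⁻¹ '' d 0)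
        rw [h]
        exact hfacet
      | succ i => exact (facet_image w₀⁻¹).2 (hy i)
    · have hlast : revProd (Fin.cons w₀ w : Fin (n + 1) → (V ≃ₗᵢ[ℝ] V)) (Fin.last (n + 1)) =
          revProd w (Fin.last n) * w₀ := revProd_cons w₀ w (Fin.last n)
      funext i
      rw [hlast]
      cases i using Fin.cases with
      | zero =>
        change revProd w (Fin.last n) (w₀ (w₀⁻¹ (v 0))) = v 0
        rw [apply_inv_apply]
        refine apply_eq_of_mem_reflGroup (hidx.revProd_mem hd _) ?_
        rintro _ ⟨α, hα, rfl⟩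
        rw [real_inner_comm, ← inner_inv_apply, real_inner_comm]
        exact hfacet.2 α hα
      | succ i =>
        change revProd w (Fin.last n) (w₀ (w₀⁻¹ (y i))) = v i.succ
        rw [apply_inv_apply]
        exact congrFun hyv i

/-- The translate `u(c)` of a flag of simple roots is a decreasing chain starting from a base with
the same reflection group. -/
theorem IsFlag.image_chain (hΦ : IsRootSystem Φ) (hΓ : IsBase Φ Γ) {u : V ≃ₗᵢ[ℝ] V}
    (hu : u ∈ reflGroup Γ) {c : Fin (n + 1) → Set V} (hc : IsFlag Γ c) :
    Antitone (fun i => u '' c i) ∧ IsBase Φ (u '' c 0) ∧ reflGroup (u '' c 0) = reflGroup Γ := by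
  refine ⟨fun i j hij => Set.image_mono (hc.2 hij), ?_, ?_⟩
  · rw [hc.1]
    exact hΓ.image hΦ (hΓ.reflGroup_le hu)
  · rw [hc.1, reflGroup_image_of_mem hu]

theorem closure_stratum_eq [FiniteDimensional ℝ V] (hΦ : IsRootSystem Φ) (hΓ : IsBase Φ Γ)
    (hΛ : IsBase Φ Λ) (hΓΛ : reflGroup Γ ≤ reflGroup Λ) {u : V ≃ₗᵢ[ℝ] V}
    (hu : u ∈ reflGroup Γ) {c : Fin (n + 1) → Set V} (hc : IsFlag Γ c) :
    closure (diag n u '' stdStratum c) =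
      ⋃ (w : Fin n → (V ≃ₗᵢ[ℝ] V)) (_ : ∀ i, w i ∈ reflGroup Φ)
        (d : Fin (n + 1) → Set V) (_ : IsFlag Λ d)
        (_ : ClosureIndex Φ (fun i => u '' c i) w d),
        diag n (revProd w (Fin.last n)) '' stdStratum d := by
  obtain ⟨hanti, hbase, hgrp⟩ := hc.image_chain hΦ hΓ hu
  rw [diag_image_stdStratum, closure_stdStratum hanti hbase.linearIndep]
  apply Set.Subset.antisymm
  · intro v hv
    obtain ⟨w, d, hd, hidx, hmem⟩ :=
      exists_closureIndex hΦ hΛ hanti hbase (hgrp.le.trans hΓΛ) hv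
    have hw : ∀ i, w i ∈ reflGroup Φ := fun i => by
      have h : w i = revProd w i.succ * (revProd w i.castSucc)⁻¹ := by
        rw [revProd_succ, mul_inv_cancel_right]
      rw [h]
      exact hΛ.reflGroup_le
        (mul_mem (hidx.revProd_mem hd _) (inv_mem (hidx.revProd_mem hd _)))
    simp only [Set.mem_iUnion]
    exact ⟨w, hw, d, hd, hidx, hmem⟩
  · simp only [Set.iUnion_subset_iff]
    exact fun w _ d hd hidx => hidx.image_subset hd

/-- Each point of the closure of a `W_Γ`-stratum lies in a `W_Λ`-stratum contained in the
closure. -/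
theorem exists_isStratum_subset_closure [FiniteDimensional ℝ V] (hΦ : IsRootSystem Φ)
    (hΓ : IsBase Φ Γ) (hΛ : IsBase Φ Λ) (hΓΛ : reflGroup Γ ≤ reflGroup Λ) {F : Set (Fin n → V)}
    (hF : IsStratum Γ F) {v : Fin n → V} (hv : v ∈ closure F) :
    ∃ G, IsStratum Λ G ∧ v ∈ G ∧ G ⊆ closure F := by
  obtain ⟨u, hu, c, hc, rfl⟩ := hF
  have heq := closure_stratum_eq hΦ hΓ hΛ hΓΛ hu hc
  have hv' := hv
  rw [heq] at hv'
  simp only [Set.mem_iUnion] at hv'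
  obtain ⟨w, hw, d, hd, hidx, hmem⟩ := hv'
  refine ⟨_, ⟨_, hidx.revProd_mem hd _, d, hd, rfl⟩, hmem, fun x hx => ?_⟩
  rw [heq]
  simp only [Set.mem_iUnion]
  exact ⟨w, hw, d, hd, hidx, hx⟩

/-- A `W_Λ`-stratum in the closure of a `W_Γ`-stratum `F`, whose linear span meets `F`, is
contained in `F`. -/
theorem IsStratum.subset_of_subset_closure [FiniteDimensional ℝ V] (hΦ : IsRootSystem Φ)
    (hΓ : IsBase Φ Γ) (hΛ : IsBase Φ Λ) {F G : Set (Fin n → V)} (hF : IsStratum Γ F)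
    (hG : IsStratum Λ G) (hGF : G ⊆ closure F) {f : Fin n → V} (hf : f ∈ F)
    (hfG : f ∈ Submodule.span ℝ G) : G ⊆ F := by
  obtain ⟨u, hu, c, hc, rfl⟩ := hF
  obtain ⟨g, hg, d, hd, rfl⟩ := hG
  obtain ⟨hanti, hbase, -⟩ := hc.image_chain hΦ hΓ hu
  simp only [diag_image_stdStratum] at hGF hf hfG ⊢
  rw [closure_stdStratum hanti hbase.linearIndep] at hGF
  refine stdStratum_subset_of_subset_closed (fun i => Set.Finite.image _ ?_) hGF hf hfG
  have h : d i ⊆ Λ := hd.1 ▸ hd.2 (Fin.zero_le i)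
  exact hΦ.finite.subset (h.trans hΛ.subset)

theorem IsStratum.nonempty [FiniteDimensional ℝ V] (hΓ : IsBase Φ Γ) {F : Set (Fin n → V)}
    (hF : IsStratum Γ F) : F.Nonempty := by
  obtain ⟨u, hu, c, hc, rfl⟩ := hF
  exact (stdStratum_nonempty hc.2 (hc.1 ▸ hΓ.linearIndep)).image _

theorem IsStratum.eq_of_mem [FiniteDimensional ℝ V] (hΦ : IsRootSystem Φ) (hΓ : IsBase Φ Γ)
    {F G : Set (Fin n → V)} (hF : IsStratum Γ F) (hG : IsStratum Γ G) {v : Fin n → V}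
    (hvF : v ∈ F) (hvG : v ∈ G) : F = G := by
  obtain ⟨u, hu, c, hc, rfl⟩ := hF
  obtain ⟨g, hg, d, hd, rfl⟩ := hG
  exact stratum_eq_of_inter hΦ hΓ hc hd hu hg hvF hvG

theorem IsStratum.coneDim_lt [FiniteDimensional ℝ V] (hΦ : IsRootSystem Φ) (hΓ : IsBase Φ Γ)
    {F G : Set (Fin n → V)} (hF : IsStratum Γ F) (hG : IsStratum Γ G) (hGF : G ⊆ closure F)
    (hne : G ≠ F) : coneDim G < coneDim F := by
  have hle : Submodule.span ℝ G ≤ Submodule.span ℝ F := by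
    rw [Submodule.span_le]
    exact hGF.trans (closure_minimal Submodule.subset_span
      (Submodule.closed_of_finiteDimensional _))
  refine Submodule.finrank_lt_finrank_of_lt (hle.lt_of_ne fun heq => hne ?_)
  obtain ⟨f, hf⟩ := hF.nonempty hΓ
  obtain ⟨x, hx⟩ := hG.nonempty hΓ
  have hsub := hF.subset_of_subset_closure hΦ hΓ hΓ hG hGF hf
    (heq ▸ Submodule.subset_span hf)
  exact hG.eq_of_mem hΦ hΓ hF hx (hsub hx)

end ReflStrata

open ReflStrata
theorem theorem3p6 {V : Type*} [NormedAddCommGroup V] [InnerProductSpace ℝ V]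
    [FiniteDimensional ℝ V] (Φ : Set V) (hΦ : ReflStrata.IsRootSystem Φ)
    (Γ Λ : Set V) (hΓ : ReflStrata.IsSimpleSubsystem Φ Γ)
    (hΛ : ReflStrata.IsSimpleSubsystem Φ Λ)
    (hΓΛ : ReflStrata.reflGroup Γ ≤ ReflStrata.reflGroup Λ) (n : ℕ) (hn : 1 ≤ n) :
    -- the closure of any `W_Γ`-stratum is a union of `W_Λ`-strata
    (∀ F' : Set (Fin n → V), ReflStrata.IsStratum Γ F' →
      ∃ 𝓕 : Set (Set (Fin n → V)), (∀ F ∈ 𝓕, ReflStrata.IsStratum Λ F) ∧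
        closure F' = ⋃₀ 𝓕) ∧
    -- the explicit formula for the closure of the stratum `u(𝒳_c) = 𝒳_{u(c)}`
    (∀ u ∈ ReflStrata.reflGroup Γ, ∀ c : Fin (n + 1) → Set V, ReflStrata.IsFlag Γ c →
      closure (ReflStrata.diag n u '' ReflStrata.stdStratum c) =
        ⋃ (w : Fin n → (V ≃ₗᵢ[ℝ] V)) (_ : ∀ i, w i ∈ ReflStrata.reflGroup Φ)
          (d : Fin (n + 1) → Set V) (_ : ReflStrata.IsFlag Λ d)
          (_ : ReflStrata.ClosureIndex Φ (fun i => u '' c i) w d),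
          ReflStrata.diag n (ReflStrata.revProd w (Fin.last n)) '' ReflStrata.stdStratum d) ∧
    -- the closure of a stratum is the disjoint union of it and strata of smaller dimension
    (∀ F : Set (Fin n → V), ReflStrata.IsStratum Γ F →
      ∃ 𝓕 : Set (Set (Fin n → V)),
        (∀ G ∈ 𝓕, ReflStrata.IsStratum Γ G ∧ ReflStrata.coneDim G < ReflStrata.coneDim F) ∧
        (insert F 𝓕).PairwiseDisjoint id ∧ closure F = ⋃₀ insert F 𝓕) ∧
    -- any `W_Γ`-stratum is a union of `W_Λ`-strata
    (∀ F' : Set (Fin n → V), ReflStrata.IsStratum Γ F' →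
      ∃ 𝓕 : Set (Set (Fin n → V)), (∀ F ∈ 𝓕, ReflStrata.IsStratum Λ F) ∧ F' = ⋃₀ 𝓕) := by
  have bΓ := hΓ.isBase
  have bΛ := hΛ.isBase
  refine ⟨fun F hF => ?_, fun u hu c hc => closure_stratum_eq hΦ bΓ bΛ hΓΛ hu hc,
    fun F hF => ?_, fun F hF => ?_⟩
  · refine ⟨{G | IsStratum Λ G ∧ G ⊆ closure F}, fun G hG => hG.1,
      Set.Subset.antisymm (fun v hv => ?_) (Set.sUnion_subset fun G hG => hG.2)⟩
    obtain ⟨G, hG, hvG, hsub⟩ := exists_isStratum_subset_closure hΦ bΓ bΛ hΓΛ hF hv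
    exact ⟨G, ⟨hG, hsub⟩, hvG⟩
  · refine ⟨{G | IsStratum Γ G ∧ G ⊆ closure F ∧ G ≠ F},
      fun G hG => ⟨hG.1, hF.coneDim_lt hΦ bΓ hG.1 hG.2.1 hG.2.2⟩, ?_, ?_⟩
    · have hstr : ∀ G ∈ insert F {G | IsStratum Γ G ∧ G ⊆ closure F ∧ G ≠ F},
          IsStratum Γ G := by
        rintro G (rfl | hG)
        · exact hF
        · exact hG.1
      intro G hG G' hG' hne
      exact Set.disjoint_left.2 fun v hv hv' =>
        hne ((hstr G hG).eq_of_mem hΦ bΓ (hstr G' hG') hv hv')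
    · refine Set.Subset.antisymm (fun v hv => ?_) (Set.sUnion_subset ?_)
      · obtain ⟨G, hG, hvG, hsub⟩ := exists_isStratum_subset_closure hΦ bΓ bΓ le_rfl hF hv
        by_cases h : G = F
        · exact ⟨F, Set.mem_insert _ _, h ▸ hvG⟩
        · exact ⟨G, Set.mem_insert_of_mem _ ⟨hG, hsub, h⟩, hvG⟩
      · rintro G (rfl | hG)
        · exact subset_closure
        · exact hG.2.1
  · refine ⟨{G | IsStratum Λ G ∧ G ⊆ F}, fun G hG => hG.1,
      Set.Subset.antisymm (fun v hv => ?_) (Set.sUnion_subset fun G hG => hG.2)⟩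
    obtain ⟨G, hG, hvG, hsub⟩ :=
      exists_isStratum_subset_closure hΦ bΓ bΛ hΓΛ hF (subset_closure hv)
    exact ⟨G, ⟨hG, hF.subset_of_subset_closure hΦ bΓ bΛ hG hsub hv
      (Submodule.subset_span hvG)⟩, hvG⟩
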